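/- Fix an inverse temperature $b>0$. For a finite alphabet $\mathfrak B$, $\mathfrak B^*$ is the free monoid on $\mathfrak B$, with unit $\epsilon$ (the empty word). **Decimation.** For $J_1,J_2\ge 0$ let $\mathcal R(J_1,J_2)=\frac1{2b}\log\frac{\cosh(bJ_1+bJ_2)}{\cosh(bJ_1-bJ_2)}$. For $J:\mathfrak B\to\mathbb R_{\ge0}$ and a nonempty word $w=b_1\cdots b_n$, let $\mathcal R(J_w)$ be the iterate of this operation on $J_{b_1},\dots,J_{b_n}$ (with $\mathcal R(J_w)=J_{b_1}$ if $n=1$). Given homomorphisms $\alpha:\mathfrak A^*\to\mathfrak B^*$, $\beta:\mathfrak A^*\to\mathfrak C^*$ and couplings $J$ on $\mathfrak B$, $J'$ on $\mathfrak C$, we say that $\hat J:\mathfrak A\to\mathbb R_{\ge 0}$ satisfies $(*)$ if $\hat J_a=\mathcal R(J_{\alpha(a)})$ whenever $\alpha(a)\ne\epsilon$, $\hat J_a=\mathcal R(J'_{\beta(a)})$ whenever $\beta(a)\neq\epsilon$, and $\hat J_a=0$ if $\alpha(a)=\beta(a)=\epsilon$. **The category $\mathcal{CFLJ}$.** Objects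 are pairs $(\mathcal L,J)$ of a nonempty context-free language $\mathcal L\subset\mathfrak B^*$ over a finite alphabet and a function $J:\mathfrak B\to\mathbb R_{\ge0}$. The morphisms $(\mathcal L,J)\to(\mathcal L',J')$, with $\mathcal L'\subset\mathfrak C^*$, are the identities together with the nontrivial morphisms, which are given by $(\mathfrak A,\alpha,\beta,\mathcal L_{reg},\hat J)$, where $\mathfrak A$ is a finite alphabet, $\alpha:\mathfrak A^*\to\mathfrak B^*$ and $\beta:\mathfrak A^*\to\mathfrak C^*$ are homomorphisms with $\mathcal L\subset\alpha(\mathfrak A^*)$ and $\mathcal L'\subset\beta(\mathfrak A^*)$, $\mathcal L_{reg}\subset\mathfrak A^*$ is a regular language with $\beta(\alpha^{-1}(\mathcal L)\cap\mathcal L_{reg})\subset\mathcal L'$, and $\hat J$ satisfies $(*)$. Here $\mathcal L_{reg}$ is identified with the set $X=(\alpha\times\beta)(\mathcal L_{reg})\subset\mathfrak B^*\times\mathfrak C^*$, and data that differ by a bijective relabeling of $\mathfrak A$ are identified. The composite of $(\mathfrak A,\alpha,\beta,\mathcal L_{reg},\hat J)$ followed by $(\mathfrak A',\alpha',\beta',\mathcal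 L'_{reg},\hat J')$ has alphabet $\mathfrak A\sqcup\mathfrak A'$, homomorphisms $\alpha\circ\pi_{\mathfrak A}$ and $\beta'\circ\pi_{\mathfrak A'}$ (with $\pi_{\mathfrak A},\pi_{\mathfrak A'}$ the projections from $(\mathfrak A\sqcup\mathfrak A')^*$), the set $$\{(\alpha\pi_{\mathfrak A}(w),\beta'\pi_{\mathfrak A'}(w)) : w\in(\mathfrak A\sqcup\mathfrak A')^*,\ \pi_{\mathfrak A}(w)\in\mathcal L_{reg},\ \pi_{\mathfrak A'}(w)\in\mathcal L'_{reg},\ \beta\pi_{\mathfrak A}(w)=\alpha'\pi_{\mathfrak A'}(w)\},$$ and couplings $\hat J$ on $\mathfrak A$ and $\hat J'$ on $\mathfrak A'$, except that letters killed by both $\alpha\circ\pi_{\mathfrak A}$ and $\beta'\circ\pi_{\mathfrak A'}$ have coupling $0$. **The category $\mathcal S$.** Objects are the spin chain sets $S_\Upsilon$, $\Upsilon=(\mathfrak B,\Omega,J)$, with $\mathfrak B$ a finite alphabet, $\emptyset\ne\Omega\subset\mathfrak B^*$ and $J:\mathfrak B\to\mathbb R_{\ge0}$; $S_\Upsilon=\bigsqcup_{w\in\Omega}S_w$,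 where $S_w$ is the Ising chain with Hamiltonian $-\sum_{j=1}^{\ell(w)}J_{w_j}\sigma_j\sigma_{j+1}$. The morphisms from $S_\Upsilon$ to $S_{\Upsilon'}$, $\Upsilon'=(\mathfrak C,\Omega',J')$, are the identities together with the common decimations and disconnections $(S_{\hat\Upsilon},\alpha,\beta)$. These consist of a finite alphabet $\mathfrak A$, homomorphisms $\alpha:\mathfrak A^*\to\mathfrak B^*$ and $\beta:\mathfrak A^*\to\mathfrak C^*$ with $\Omega\subset\alpha(\mathfrak A^*)$ and $\Omega'\subset\beta(\mathfrak A^*)$, and $\hat\Upsilon=(\mathfrak A_o,\hat\Omega,\hat J)$, where $\mathfrak A_o=\mathfrak A\sqcup\{o\}$, the restriction of $\hat J:\mathfrak A_o\to\mathbb R_{\ge 0}$ to $\mathfrak A$ satisfies $(*)$, $\hat J_o=0$, $\hat\Omega\subset\alpha^{-1}(\Omega)_o$ (possibly empty) and $\beta_o(\hat\Omega)\subset\Omega'$. Here $\alpha_o,\beta_o$ extend $\alpha,\beta$ by $o\mapsto\epsilon$, and for $V\subset\mathfrak A^*$ the set $V_o$ consists of the words $v_o$, $v\in V$, obtained from $v$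 by inserting $o$ between any two adjacent letters $a,a'$ for which not both $\alpha(a)=\epsilon\Leftrightarrow\alpha(a')=\epsilon$ and $\beta(a)=\epsilon\Leftrightarrow\beta(a')=\epsilon$ hold. Again $\hat\Omega$ is identified with its image $(\alpha_o\times\beta_o)(\hat\Omega)\subset\Omega\times\Omega'$, and data that differ by a relabeling of $\mathfrak A$ are identified. The composite of two common decimations has alphabet $\mathfrak A\sqcup\mathfrak A'$, homomorphisms and couplings as in $\mathcal{CFLJ}$, and words $$\{w : \pi_{\mathfrak A}(w)_o\in\hat\Omega,\ \pi_{\mathfrak A'}(w)_o\in\hat\Omega',\ \beta\pi_{\mathfrak A}(w)=\alpha'\pi_{\mathfrak A'}(w)\}_o .$$ **Theorem.** 1. For $\mathfrak A,\alpha,\beta,\mathcal L_{reg}$ as in the definition of a nontrivial morphism $(\mathcal L,J)\to(\mathcal L',J')$, there is a (then unique) $\hat J$ satisfying $(*)$ if and only if $\mathcal R(J_{\alpha(a)})=\mathcal R(J'_{\beta(a)})$ for all $a\in\mathfrak A$ with $\alpha(a)\ne\epsilon\ne\beta(a)$. 2. With these compositions $\mathcal{CFLJ}$ and $\mathcal S$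 are well-defined categories. In particular, the composite of nontrivial morphisms of $\mathcal{CFLJ}$ is again presented by a regular language in $(\mathfrak A\sqcup\mathfrak A')^*$. 3. There is a functor $\mathfrak S:\mathcal{CFLJ}\to\mathcal S$ with $\mathfrak S(\mathcal L,J)=S_\Upsilon=\bigsqcup_{w\in\mathcal L}S_w$, $\Upsilon=(\mathfrak B,\mathcal L,J)$, that sends a nontrivial morphism $(\mathfrak A,\alpha,\beta,\mathcal L_{reg},\hat J)$ to the common decimation and disconnection $(S_{\hat\Upsilon},\alpha,\beta)$ with couplings $\hat J$ on $\mathfrak A$, $\hat J_o=0$, and words $\{w\in\mathcal L_{reg}:\alpha(w)\in\mathcal L,\ \beta(w)\in\mathcal L'\}_o$, whose image in $\mathfrak B^*\times\mathfrak C^*$ is $X\cap(\mathcal L\times\mathcal L')$. -/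

import Mathlib

open scoped NNReal

/-! ### Ising chains and spin decimation -/

/-- A one-dimensional Ising chain with `length` bonds: bond `j` joins the consecutive spins
`j` and `j + 1`, with interaction strength `coupling j`, and `magnetization j` is the external
field at the spin `j`. -/
structure IsingChain where
  length : ℕ
  coupling : Fin length → ℝ
  magnetization : Fin length → ℝ

/-- The Hamiltonian `-∑ J_j σ_j σ_{j+1} - ∑ H_j σ_j` on spin configurations with values `±1`. -/
noncomputable def IsingChain.hamiltonian (S : IsingChain) (σ : Fin (S.length + 1) → ℤˣ) : ℝ :=
  - ∑ j : Fin S.length, S.coupling j * ((σ j.castSucc : ℤ) : ℝ) * ((σ j.succ : ℤ) : ℝ)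
    - ∑ j : Fin S.length, S.magnetization j * ((σ j.castSucc : ℤ) : ℝ)

/-- The chain `S_w` of a word `w`: one bond for each letter, with `J_j = J_a` if the `j`-th letter
is `a`, and no external field. -/
noncomputable def wordChain {A : Type} (J : A → ℝ≥0) (w : FreeMonoid A) : IsingChain where
  length := w.toList.length
  coupling := fun j => (J (w.toList.get j) : ℝ)
  magnetization := fun _ => 0

/-- A (disjoint) family of Ising chains. -/
structure ChainSystem where
  index : Type
  chain : index → IsingChain

/-- Spin decimation at inverse temperature `b`: the new coupling that replaces two adjacent
couplings `J₁`, `J₂` when their common spin is summed out. With `K = b * J`, it is given by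
`K' = (1 / 2) * log (cosh (K₁ + K₂) / cosh (K₁ - K₂))`. -/
noncomputable def decimate (b J₁ J₂ : ℝ) : ℝ :=
  (1 / b) * ((1 / 2) * Real.log (Real.cosh (b * J₁ + b * J₂) / Real.cosh (b * J₁ - b * J₂)))

/-- Iterated decimation along a list of couplings, down to one coupling. The value at the empty
list is a convention that is never used. -/
noncomputable def decimateList (b : ℝ) : List ℝ → ℝ
  | [] => 0
  | [x] => x
  | x :: y :: l => decimate b x (decimateList b (y :: l))

/-- `R(J_w)`: all the inner spins of the chain of the (nonempty) word `w` are summed out. -/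
noncomputable def decimateWord (b : ℝ) {B : Type} (J : B → ℝ≥0) (w : FreeMonoid B) : ℝ :=
  decimateList b (w.toList.map fun a => (J a : ℝ))

/-- The defining relation between the couplings `Jhat` on the alphabet `A` and the couplings `J`
on `B` and `J'` on `C`, for homomorphisms `α : A* → B*` and `β : A* → C*`. On a letter killed by
neither, `Jhat` equals both decimations (so these have to agree). -/
structure IsHatJ (b : ℝ) {A B C : Type} (α : FreeMonoid A →* FreeMonoid B)
    (β : FreeMonoid A →* FreeMonoid C) (J : B → ℝ≥0) (J' : C → ℝ≥0) (Jhat : A → ℝ≥0) : Prop where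
  left : ∀ a, α (.of a) ≠ 1 → (Jhat a : ℝ) = decimateWord b J (α (.of a))
  right : ∀ a, β (.of a) ≠ 1 → (Jhat a : ℝ) = decimateWord b J' (β (.of a))
  zero : ∀ a, α (.of a) = 1 → β (.of a) = 1 → Jhat a = 0

/-- The compatibility condition: the two decimations agree on the letters killed by neither
`α` nor `β`. -/
def DecimationCompatible (b : ℝ) {A B C : Type} (α : FreeMonoid A →* FreeMonoid B)
    (β : FreeMonoid A →* FreeMonoid C) (J : B → ℝ≥0) (J' : C → ℝ≥0) : Prop :=
  ∀ a, α (.of a) ≠ 1 → β (.of a) ≠ 1 →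
    decimateWord b J (α (.of a)) = decimateWord b J' (β (.of a))

/-! ### Disconnection -/

/-- Insert the letter `none` (playing the role of `o`) between any two adjacent letters that do
not lie in the same piece. -/
noncomputable def insertO {A : Type} (same : A → A → Prop) : List A → List (Option A)
  | [] => []
  | [a] => [some a]
  | a :: c :: l =>
    haveI := Classical.propDecidable (same a c)
    if same a c then some a :: insertO same (c :: l)
    else some a :: none :: insertO same (c :: l)

/-- The word obtained from `w` by inserting `o` between adjacent letters in different pieces. -/
noncomputable def disconnectWord {A : Type} (same : A → A → Prop) (w : FreeMonoid A) :
    FreeMonoid (Option A) :=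
  FreeMonoid.ofList (insertO same w.toList)

/-- The extension `α_o` of `α` with `α_o(o) = ε`. -/
def extendO {A B : Type} (α : FreeMonoid A →* FreeMonoid B) :
    FreeMonoid (Option A) →* FreeMonoid B :=
  FreeMonoid.lift fun x => x.elim 1 fun a => α (.of a)

/-- Two letters lie in the same piece of the four-piece decomposition of the alphabet given by
whether or not `α` kills the letter and whether or not `β` does. -/
def samePiece {A B C : Type} (α : FreeMonoid A →* FreeMonoid B)
    (β : FreeMonoid A →* FreeMonoid C) (a a' : A) : Prop :=
  (α (.of a) = 1 ↔ α (.of a') = 1) ∧ (β (.of a) = 1 ↔ β (.of a') = 1)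

/-- The disconnection `α⁻¹(Ω)_o` of `Ω` with respect to the pieces cut out by `α` and `β`. -/
def disconnection {A B C : Type} (α : FreeMonoid A →* FreeMonoid B)
    (β : FreeMonoid A →* FreeMonoid C) (Ω : Set (FreeMonoid B)) : Set (FreeMonoid (Option A)) :=
  disconnectWord (samePiece α β) '' (α ⁻¹' Ω)

theorem extendO_insertO {A B : Type} (α : FreeMonoid A →* FreeMonoid B) (same : A → A → Prop)
    (l : List A) : extendO α (.ofList (insertO same l)) = α (.ofList l) := by
  have hs : ∀ (a : A) (l : List (Option A)), extendO α (.ofList (some a :: l)) =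
      α (.of a) * extendO α (.ofList l) := fun a l => by
    rw [FreeMonoid.ofList_cons, map_mul]; rfl
  have hn : ∀ l : List (Option A), extendO α (.ofList (none :: l)) =
      extendO α (.ofList l) := fun l => by
    rw [FreeMonoid.ofList_cons, map_mul]
    exact one_mul _
  match l with
  | [] => simp [insertO]
  | [a] => rw [insertO, hs]; simp [FreeMonoid.ofList_cons]
  | a :: c :: l =>
    have ih := extendO_insertO α same (c :: l)
    rw [insertO, FreeMonoid.ofList_cons a, map_mul, ← ih]
    split_ifs
    · rw [hs]
    · rw [hs, hn]

theorem extendO_disconnectWord {A B : Type} (α : FreeMonoid A →* FreeMonoid B)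
    (same : A → A → Prop) (w : FreeMonoid A) :
    extendO α (disconnectWord same w) = α w :=
  extendO_insertO α same w.toList

/-! ### Projections from the free monoid on a disjoint union of alphabets -/

def projLeft (A A' : Type) : FreeMonoid (A ⊕ A') →* FreeMonoid A :=
  FreeMonoid.lift (Sum.elim FreeMonoid.of fun _ => 1)

def projRight (A A' : Type) : FreeMonoid (A ⊕ A') →* FreeMonoid A' :=
  FreeMonoid.lift (Sum.elim (fun _ => 1) FreeMonoid.of)

theorem projLeft_map_inl {A A' : Type} (w : FreeMonoid A) :
    projLeft A A' (FreeMonoid.map Sum.inl w) = w := by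
  have h : (projLeft A A').comp (FreeMonoid.map Sum.inl) = MonoidHom.id _ :=
    FreeMonoid.hom_eq fun _ => rfl
  exact DFunLike.congr_fun h w

theorem projRight_map_inr {A A' : Type} (w : FreeMonoid A') :
    projRight A A' (FreeMonoid.map Sum.inr w) = w := by
  have h : (projRight A A').comp (FreeMonoid.map Sum.inr) = MonoidHom.id _ :=
    FreeMonoid.hom_eq fun _ => rfl
  exact DFunLike.congr_fun h w

/-- The couplings of a composite, on the disjoint union of the two alphabets: those of the two
factors, except that a letter killed by both homomorphisms of the composite gets `0`. -/
noncomputable def compJ {A A' B D : Type} (α : FreeMonoid A →* FreeMonoid B)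
    (β' : FreeMonoid A' →* FreeMonoid D) (Jhat : A → ℝ≥0) (Jhat' : A' → ℝ≥0) :
    A ⊕ A' → ℝ≥0 := fun x =>
  haveI := Classical.dec
  x.elim (fun a => if α (.of a) = 1 then 0 else Jhat a)
    (fun a' => if β' (.of a') = 1 then 0 else Jhat' a')

theorem isHatJ_compJ {b : ℝ} {A A' B C D : Type} {α : FreeMonoid A →* FreeMonoid B}
    {β : FreeMonoid A →* FreeMonoid C} {α' : FreeMonoid A' →* FreeMonoid C}
    {β' : FreeMonoid A' →* FreeMonoid D} {J : B → ℝ≥0} {J' : C → ℝ≥0} {J'' : D → ℝ≥0}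
    {Jhat : A → ℝ≥0} {Jhat' : A' → ℝ≥0} (h : IsHatJ b α β J J' Jhat)
    (h' : IsHatJ b α' β' J' J'' Jhat') :
    IsHatJ b (α.comp (projLeft A A')) (β'.comp (projRight A A')) J J''
      (compJ α β' Jhat Jhat') := by
  have ll : ∀ a : A, projLeft A A' (.of (.inl a)) = .of a := fun _ => rfl
  have lr : ∀ a : A', projLeft A A' (.of (.inr a)) = 1 := fun _ => rfl
  have rl : ∀ a : A, projRight A A' (.of (.inl a)) = 1 := fun _ => rfl
  have rr : ∀ a : A', projRight A A' (.of (.inr a)) = .of a := fun _ => rfl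
  constructor
  · rintro (a | a) ha
    · have ha' : α (.of a) ≠ 1 := ha
      simpa [compJ, ll, ha'] using h.left a ha'
    · exact absurd (by simp [lr]) ha
  · rintro (a | a) ha
    · exact absurd (by simp [rl]) ha
    · have ha' : β' (.of a) ≠ 1 := ha
      simpa [compJ, rr, ha'] using h'.right a ha'
  · rintro (a | a) ha hb
    · have ha' : α (.of a) = 1 := ha
      simp [compJ, ha']
    · have hb' : β' (.of a) = 1 := hb
      simp [compJ, hb']

/-! ### Categories with prescribed objects and morphisms -/

/-- Identities and an associative, unital composition on a given family of types of morphisms. -/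
structure CategoryOn (Ob : Type 1) (Hom : Ob → Ob → Type 1) where
  id : ∀ X, Hom X X
  comp : ∀ {X Y Z}, Hom X Y → Hom Y Z → Hom X Z
  id_comp : ∀ {X Y} (f : Hom X Y), comp (id X) f = f
  comp_id : ∀ {X Y} (f : Hom X Y), comp f (id Y) = f
  assoc : ∀ {W X Y Z} (f : Hom W X) (g : Hom X Y) (h : Hom Y Z),
    comp (comp f g) h = comp f (comp g h)

@[reducible]
def CategoryOn.toCategory {Ob : Type 1} {Hom : Ob → Ob → Type 1} (C : CategoryOn Ob Hom) :
    CategoryTheory.Category.{1} Ob where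
  Hom := Hom
  id := C.id
  comp := C.comp
  id_comp := C.id_comp
  comp_id := C.comp_id
  assoc := C.assoc

/-- Morphisms: identities, and the given nontrivial ones. -/
inductive WithIdentities {Ob : Type 1} (M : Ob → Ob → Type 1) : Ob → Ob → Type 1
  | ident (X : Ob) : WithIdentities M X X
  | of {X Y : Ob} (m : M X Y) : WithIdentities M X Y

/-! ### The category of spin chain sets -/

/-- A finite alphabet, a set of words and nonnegative couplings. -/
structure SpinDatum where
  alphabet : Type
  finite : Finite alphabet
  words : Set (FreeMonoid alphabet)
  J : alphabet → ℝ≥0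

/-- The disjoint union of the chains `S_w`, over the words `w`. -/
noncomputable def SpinDatum.system (U : SpinDatum) : ChainSystem where
  index := U.words
  chain := fun w => wordChain U.J w.1

/-- The objects: data as above with a nonempty set of words. -/
structure SpinChainSet extends SpinDatum where
  nonempty : words.Nonempty

/-- A common decimation and disconnection of two spin chain sets. The alphabet of the decimation
is `A_o = Option A`, where `A` is the field `alphabet` and `none` is the letter `o`. -/
structure CommonDecimation (b : ℝ) (S T : SpinChainSet) where
  alphabet : Type
  finite : Finite alphabet
  α : FreeMonoid alphabet →* FreeMonoid S.alphabet
  β : FreeMonoid alphabet →* FreeMonoid T.alphabet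
  words : Set (FreeMonoid (Option alphabet))
  J : Option alphabet → ℝ≥0
  cover_left : S.words ⊆ Set.range α
  cover_right : T.words ⊆ Set.range β
  words_subset : words ⊆ disconnection α β S.words
  mapsTo : Set.MapsTo (extendO β) words T.words
  isHatJ : IsHatJ b α β S.J T.J fun a => J (some a)
  J_o : J none = 0

namespace CommonDecimation

variable {b : ℝ} {S T U : SpinChainSet}

/-- The datum of the spin chain set of a common decimation. -/
def datum (P : CommonDecimation b S T) : SpinDatum where
  alphabet := Option P.alphabet
  finite := haveI := P.finite; inferInstance
  words := P.words
  J := P.J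

/-- The set of words of `P`, seen in `B* × C*` through `α_o` and `β_o`. -/
def graph (P : CommonDecimation b S T) : Set (FreeMonoid S.alphabet × FreeMonoid T.alphabet) :=
  (fun w => (extendO P.α w, extendO P.β w)) '' P.words

/-- Common decimations are identified if they agree up to a relabeling of the alphabet, where
their sets of words are identified with their images in `B* × C*`. -/
def Equivalent (P Q : CommonDecimation b S T) : Prop :=
  (∃ e : P.alphabet ≃ Q.alphabet, ∀ a, Q.α (.of (e a)) = P.α (.of a) ∧
    Q.β (.of (e a)) = P.β (.of a) ∧ Q.J (some (e a)) = P.J (some a)) ∧ P.graph = Q.graph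

instance setoid (b : ℝ) (S T : SpinChainSet) : Setoid (CommonDecimation b S T) where
  r := Equivalent
  iseqv :=
    { refl := fun _ => ⟨⟨Equiv.refl _, fun _ => ⟨rfl, rfl, rfl⟩⟩, rfl⟩
      symm := by
        rintro P Q ⟨⟨e, he⟩, h⟩
        refine ⟨⟨e.symm, fun a => ?_⟩, h.symm⟩
        have := he (e.symm a)
        simp only [Equiv.apply_symm_apply] at this
        exact ⟨this.1.symm, this.2.1.symm, this.2.2.symm⟩
      trans := by
        rintro P Q R ⟨⟨e, he⟩, h⟩ ⟨⟨f, hf⟩, h'⟩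
        exact ⟨⟨e.trans f, fun a => ⟨(hf (e a)).1.trans (he a).1,
          (hf (e a)).2.1.trans (he a).2.1, (hf (e a)).2.2.trans (he a).2.2⟩⟩, h.trans h'⟩ }

/-- Composition (first `P`, then `Q`), over the disjoint union of the two alphabets: the words are
the disconnections of the words `w` whose two projections, disconnected, are words of `P` and of
`Q`, and for which `β` of the first projection equals `α'` of the second. -/
noncomputable def comp (P : CommonDecimation b S T) (Q : CommonDecimation b T U) :
    CommonDecimation b S U where
  alphabet := P.alphabet ⊕ Q.alphabet
  finite := haveI := P.finite; haveI := Q.finite; inferInstance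
  α := P.α.comp (projLeft _ _)
  β := Q.β.comp (projRight _ _)
  words := disconnectWord (samePiece (P.α.comp (projLeft _ Q.alphabet))
      (Q.β.comp (projRight P.alphabet _))) ''
    {w | disconnectWord (samePiece P.α P.β) (projLeft _ _ w) ∈ P.words ∧
      disconnectWord (samePiece Q.α Q.β) (projRight _ _ w) ∈ Q.words ∧
      P.β (projLeft _ _ w) = Q.α (projRight _ _ w)}
  J := fun x => x.elim 0 (compJ P.α Q.β (fun a => P.J (some a)) fun a => Q.J (some a))
  cover_left := fun u hu => by
    obtain ⟨w, rfl⟩ := P.cover_left hu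
    exact ⟨FreeMonoid.map Sum.inl w, by simp [projLeft_map_inl]⟩
  cover_right := fun u hu => by
    obtain ⟨w, rfl⟩ := Q.cover_right hu
    exact ⟨FreeMonoid.map Sum.inr w, by simp [projRight_map_inr]⟩
  words_subset := by
    rintro _ ⟨w, ⟨hw, -, -⟩, rfl⟩
    refine ⟨w, ?_, rfl⟩
    obtain ⟨v, hv, hvw⟩ := P.words_subset hw
    have h := congrArg (extendO P.α) hvw
    rw [extendO_disconnectWord, extendO_disconnectWord] at h
    change P.α (projLeft _ _ w) ∈ S.words
    rw [← h]
    exact hv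
  mapsTo := by
    rintro _ ⟨w, ⟨-, hw, -⟩, rfl⟩
    rw [extendO_disconnectWord]
    have h := Q.mapsTo hw
    rwa [extendO_disconnectWord] at h
  isHatJ := isHatJ_compJ P.isHatJ Q.isHatJ
  J_o := rfl

end CommonDecimation

/-- Morphisms of spin chain sets: identities, and classes of common decimations. -/
abbrev SpinHom (b : ℝ) : SpinChainSet → SpinChainSet → Type 1 :=
  WithIdentities fun S T => Quotient (CommonDecimation.setoid b S T)

/-! ### Context-free languages with couplings -/

/-- A nonempty context-free language over a finite alphabet, with nonnegative couplings. -/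
structure CFLJ where
  alphabet : Type
  finite : Finite alphabet
  lang : Language alphabet
  contextFree : lang.IsContextFree
  nonempty : ∃ w, w ∈ lang
  J : alphabet → ℝ≥0

/-- The language as a subset of the free monoid. -/
def CFLJ.words (X : CFLJ) : Set (FreeMonoid X.alphabet) := {w | w.toList ∈ X.lang}

/-- A rational transduction between two context-free languages `L ⊆ B*` and `L' ⊆ C*`: an alphabet
`A`, homomorphisms `α : A* → B*`, `β : A* → C*` and a regular language `reg ⊆ A*`, such that
`L ⊆ α(A*)`, `L' ⊆ β(A*)` and `β(α⁻¹(L) ∩ reg) ⊆ L'`. -/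
structure Transduction (X Y : CFLJ) where
  alphabet : Type
  finite : Finite alphabet
  α : FreeMonoid alphabet →* FreeMonoid X.alphabet
  β : FreeMonoid alphabet →* FreeMonoid Y.alphabet
  reg : Language alphabet
  isRegular : reg.IsRegular
  cover_left : X.words ⊆ Set.range α
  cover_right : Y.words ⊆ Set.range β
  image_subset : β '' (α ⁻¹' X.words ∩ {w | w.toList ∈ reg}) ⊆ Y.words

/-- The subset of `B* × C*` with which the transduction is identified. -/
def Transduction.graph {X Y : CFLJ} (P : Transduction X Y) :
    Set (FreeMonoid X.alphabet × FreeMonoid Y.alphabet) :=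
  (fun w => (P.α w, P.β w)) '' {w | w.toList ∈ P.reg}

/-- A transduction together with couplings on its alphabet obtained by decimation. -/
structure CoupledTransduction (b : ℝ) (X Y : CFLJ) extends Transduction X Y where
  J : alphabet → ℝ≥0
  isHatJ : IsHatJ b α β X.J Y.J J

namespace CoupledTransduction

variable {b : ℝ} {X Y Z : CFLJ}

/-- Transductions are identified if they agree up to a relabeling of the alphabet, where the
regular languages are identified with their images in `B* × C*`. -/
def Equivalent (P Q : CoupledTransduction b X Y) : Prop :=
  (∃ e : P.alphabet ≃ Q.alphabet, ∀ a, Q.α (.of (e a)) = P.α (.of a) ∧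
    Q.β (.of (e a)) = P.β (.of a) ∧ Q.J (e a) = P.J a) ∧ P.graph = Q.graph

instance setoid (b : ℝ) (X Y : CFLJ) : Setoid (CoupledTransduction b X Y) where
  r := Equivalent
  iseqv :=
    { refl := fun _ => ⟨⟨Equiv.refl _, fun _ => ⟨rfl, rfl, rfl⟩⟩, rfl⟩
      symm := by
        rintro P Q ⟨⟨e, he⟩, h⟩
        refine ⟨⟨e.symm, fun a => ?_⟩, h.symm⟩
        have := he (e.symm a)
        simp only [Equiv.apply_symm_apply] at this
        exact ⟨this.1.symm, this.2.1.symm, this.2.2.symm⟩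
      trans := by
        rintro P Q R ⟨⟨e, he⟩, h⟩ ⟨⟨f, hf⟩, h'⟩
        exact ⟨⟨e.trans f, fun a => ⟨(hf (e a)).1.trans (he a).1,
          (hf (e a)).2.1.trans (he a).2.1, (hf (e a)).2.2.trans (he a).2.2⟩⟩, h.trans h'⟩ }

/-- The language of the composite: words over the disjoint union of the alphabets whose
projections lie in the two regular languages, with `β` of the first projection equal to `α'` of
the second. -/
def compLang (P : CoupledTransduction b X Y) (Q : CoupledTransduction b Y Z) :
    Set (FreeMonoid (P.alphabet ⊕ Q.alphabet)) :=
  {w | (projLeft _ _ w).toList ∈ P.reg ∧ (projRight _ _ w).toList ∈ Q.reg ∧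
    P.β (projLeft _ _ w) = Q.α (projRight _ _ w)}

/-- `R` represents the composite of `P` followed by `Q`: up to relabeling, its alphabet is the
disjoint union of the two alphabets, its homomorphisms are `α ∘ π` and `β' ∘ π'`, its couplings are
those of a composite, and the subset of `B* × D*` it is identified with is the image of
`compLang P Q`. -/
def IsComposite (P : CoupledTransduction b X Y) (Q : CoupledTransduction b Y Z)
    (R : CoupledTransduction b X Z) : Prop :=
  (∃ e : P.alphabet ⊕ Q.alphabet ≃ R.alphabet, ∀ x,
    R.α (.of (e x)) = P.α (projLeft _ _ (.of x)) ∧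
    R.β (.of (e x)) = Q.β (projRight _ _ (.of x)) ∧
    R.J (e x) = compJ P.α Q.β P.J Q.J x) ∧
  R.graph = (fun w => (P.α (projLeft _ _ w), Q.β (projRight _ _ w))) '' compLang P Q

end CoupledTransduction

/-- Morphisms of context-free languages with couplings: identities, and classes of coupled
transductions. -/
abbrev CFLJHom (b : ℝ) : CFLJ → CFLJ → Type 1 :=
  WithIdentities fun X Y => Quotient (CoupledTransduction.setoid b X Y)

/-! ### The assignment of spin chain sets to languages -/

/-- `(L, J)` is sent to the spin chain set of `(B, L, J)`. -/
abbrev spinObj (X : CFLJ) : SpinChainSet where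
  alphabet := X.alphabet
  finite := X.finite
  words := X.words
  J := X.J
  nonempty := X.nonempty

/-- The common decimation and disconnection of a coupled transduction: the words are the
disconnections of the `w ∈ reg` with `(α(w), β(w)) ∈ L × L'`. -/
noncomputable def toDecimation {b : ℝ} {X Y : CFLJ} (P : CoupledTransduction b X Y) :
    CommonDecimation b (spinObj X) (spinObj Y) where
  alphabet := P.alphabet
  finite := P.finite
  α := P.α
  β := P.β
  words := disconnectWord (samePiece P.α P.β) ''
    {w | w.toList ∈ P.reg ∧ P.α w ∈ X.words ∧ P.β w ∈ Y.words}
  J := fun x => x.elim 0 P.J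
  cover_left := P.cover_left
  cover_right := P.cover_right
  words_subset := by
    rintro _ ⟨w, hw, rfl⟩
    exact ⟨w, hw.2.1, rfl⟩
  mapsTo := by
    rintro _ ⟨w, hw, rfl⟩
    have h := extendO_disconnectWord P.β (samePiece P.α P.β) w
    exact Set.mem_of_eq_of_mem h hw.2.2
  isHatJ := P.isHatJ
  J_o := rfl

theorem toDecimation_graph {b : ℝ} {X Y : CFLJ} (P : CoupledTransduction b X Y) :
    (toDecimation P).graph = P.graph ∩ X.words ×ˢ Y.words := by
  have h : ∀ w : FreeMonoid P.alphabet,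
      (extendO (toDecimation P).α (disconnectWord (samePiece P.α P.β) w),
        extendO (toDecimation P).β (disconnectWord (samePiece P.α P.β) w)) =
      (P.α w, P.β w) := fun w =>
    Prod.ext (extendO_disconnectWord P.α _ w) (extendO_disconnectWord P.β _ w)
  ext p
  constructor
  · rintro ⟨_, ⟨w, ⟨h1, h2, h3⟩, rfl⟩, hp⟩
    have hp' : (P.α w, P.β w) = p := (h w).symm.trans hp
    subst hp'
    exact ⟨⟨w, h1, rfl⟩, h2, h3⟩
  · rintro ⟨⟨w, h1, hp⟩, h2⟩
    have hp' : (P.α w, P.β w) = p := hp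
    subst hp'
    exact ⟨_, ⟨w, ⟨h1, h2.1, h2.2⟩, rfl⟩, h w⟩

theorem toDecimation_equivalent {b : ℝ} {X Y : CFLJ} {P Q : CoupledTransduction b X Y}
    (h : P.Equivalent Q) : (toDecimation P).Equivalent (toDecimation Q) :=
  ⟨h.1, by rw [toDecimation_graph, toDecimation_graph, h.2]⟩

/-- The assignment on morphisms. -/
noncomputable def spinMap (b : ℝ) : {X Y : CFLJ} → CFLJHom b X Y →
    SpinHom b (spinObj X) (spinObj Y)
  | _, _, .ident X => .ident (spinObj X)
  | _, _, .of m => .of (Quotient.map toDecimation (fun _ _ h => toDecimation_equivalent h) m)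

/-!
Decimated couplings are nonnegative because `cosh (K₁ - K₂) ≤ cosh (K₁ + K₂)` for `K₁, K₂ ≥ 0`.
Hence the equations that define `Jhat` can be solved letter by letter, uniquely, unless a letter
killed by neither homomorphism gets two different values (`existsUnique_isHatJ_iff`).

In both categories the relation in `B* × D*` attached to a composite is the composite of the two
relations (`CommonDecimation.graph_comp`, `CoupledTransduction.graph_comp`). For common decimations
this uses that every word is the disconnection of a word without `o`, and that any `v ∈ A*` and
`v' ∈ A'*` are the projections of one word over `A ⊕ A'`. So composition respects the
identifications and is associative, by the corresponding facts for relations together with those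
for the couplings (`compJ_congr`, `compJ_assoc`). Identities are adjoined freely
(`WithIdentities.categoryOn`).

The substantial point is that a composite of transductions is again presented by a regular language
over `A ⊕ A'`. The set `compLang` itself need not be regular, since comparing `β (πw)` with
`α' (π'w)` may take unbounded memory. But only its image in `B* × D*` matters, and that image
does not depend on how the letters of `πw` and `π'w` are interleaved. If one always reads a letter
on the side that is behind, then the lead of the other side never exceeds the length of the image
of one letter, so a finite automaton can store it (`exists_regular_synchronization`).

Finally, `β (α⁻¹(L) ∩ reg) ⊆ L'` forces the intermediate word of a composable pair to lie in the
middle language, so cutting the relations down to pairs of words of the languages commutes with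
composition (`CoupledTransduction.toDecimation_comp_equivalent`). This is functoriality.
-/

/-! ### Nonnegativity of decimated couplings -/

theorem decimate_nonneg {b x y : ℝ} (hb : 0 < b) (hx : 0 ≤ x) (hy : 0 ≤ y) :
    0 ≤ decimate b x y := by
  have hle : Real.cosh (b * x - b * y) ≤ Real.cosh (b * x + b * y) := by
    rw [Real.cosh_le_cosh]
    have h1 : 0 ≤ b * x := by positivity
    have h2 : 0 ≤ b * y := by positivity
    rw [abs_of_nonneg (add_nonneg h1 h2), abs_le]
    constructor <;> linarith
  have hlog := Real.log_nonneg ((one_le_div (Real.cosh_pos _)).2 hle)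
  unfold decimate
  positivity

theorem decimateList_nonneg {b : ℝ} (hb : 0 < b) :
    ∀ l : List ℝ, (∀ x ∈ l, 0 ≤ x) → 0 ≤ decimateList b l
  | [], _ => le_rfl
  | [x], h => h x (by simp)
  | x :: y :: l, h => decimate_nonneg hb (h x (by simp))
      (decimateList_nonneg hb (y :: l) fun z hz => h z (List.mem_cons_of_mem x hz))

theorem decimateWord_nonneg {b : ℝ} (hb : 0 < b) {B : Type} (J : B → ℝ≥0) (w : FreeMonoid B) :
    0 ≤ decimateWord b J w :=
  decimateList_nonneg hb _ fun x hx => by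
    obtain ⟨a, -, rfl⟩ := List.mem_map.1 hx
    exact (J a).2

theorem existsUnique_isHatJ_iff {b : ℝ} (hb : 0 < b) {A B C : Type}
    (α : FreeMonoid A →* FreeMonoid B) (β : FreeMonoid A →* FreeMonoid C)
    (J : B → ℝ≥0) (J' : C → ℝ≥0) :
    (∃! Jhat : A → ℝ≥0, IsHatJ b α β J J' Jhat) ↔ DecimationCompatible b α β J J' := by
  classical
  constructor
  · rintro ⟨K, hK, -⟩ a ha hb
    rw [← hK.left a ha, ← hK.right a hb]
  · intro h
    refine ⟨fun a => if α (.of a) = 1 then if β (.of a) = 1 then 0 else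
        (decimateWord b J' (β (.of a))).toNNReal
      else (decimateWord b J (α (.of a))).toNNReal, ⟨?_, ?_, ?_⟩, ?_⟩
    · intro a ha
      simp [ha, decimateWord_nonneg hb]
    · intro a ha'
      by_cases ha : α (.of a) = 1
      · simp [ha, ha', decimateWord_nonneg hb]
      · simp [ha, h a ha ha', decimateWord_nonneg hb]
    · intro a ha ha'
      simp [ha, ha']
    · intro K hK
      funext a
      by_cases ha : α (.of a) = 1
      · by_cases ha' : β (.of a) = 1
        · simp [ha, ha', hK.zero a ha ha']
        · simp [ha, ha', ← hK.right a ha']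
      · simp [ha, ← hK.left a ha]

/-! ### Regular languages that synchronize two homomorphisms -/

/-- Preimages of regular languages under homomorphisms of free monoids are regular. -/
theorem Language.IsRegular.preimage_hom {A B : Type} {L : Language B} (hL : L.IsRegular)
    (φ : FreeMonoid A →* FreeMonoid B) :
    Language.IsRegular {w : List A | (φ (.ofList w)).toList ∈ L} := by
  obtain ⟨σ, hσ, M, rfl⟩ := hL
  let N : DFA A σ :=
    { step := fun s a => M.evalFrom s (φ (.of a)).toList
      start := M.start
      accept := M.accept }
  have hN : ∀ (w : List A) (s : σ), N.evalFrom s w = M.evalFrom s (φ (.ofList w)).toList := by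
    intro w
    induction w with
    | nil => intro s; simp
    | cons a w ih =>
      intro s
      rw [DFA.evalFrom_cons, ih, FreeMonoid.ofList_cons, map_mul, FreeMonoid.toList_mul,
        DFA.evalFrom_of_append]
  refine ⟨σ, hσ, N, ?_⟩
  ext w
  change N.evalFrom M.start w ∈ M.accept ↔ M.evalFrom M.start (φ (.ofList w)).toList ∈ M.accept
  rw [hN]

/-- Levi's lemma: of two prefixes of the same word, one is a prefix of the other. -/
theorem FreeMonoid.mul_eq_mul_cases {C : Type} {x u y v : FreeMonoid C} (h : x * u = y * v) :
    (∃ t, y = x * t ∧ u = t * v) ∨ ∃ t, x = y * t ∧ v = t * u :=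
  List.append_eq_append_iff.1 h

section Synchronization

variable {A A' C : Type} (β : FreeMonoid A →* FreeMonoid C) (γ : FreeMonoid A' →* FreeMonoid C)

/-- The pairs of words over `C` of length at most `n`: the parts of `β (πw)` and `γ (π'w)`, after
reading `w`, that have not yet been matched with each other. -/
abbrev Buffers (C : Type) (n : ℕ) : Type :=
  {p : FreeMonoid C × FreeMonoid C // p.1.length ≤ n ∧ p.2.length ≤ n}

/-- The automaton that appends the image of each letter to the corresponding buffer, and then may
cancel a common prefix `c` of the two buffers. It accepts when both buffers are empty. -/
def syncNFA (n : ℕ) : NFA (A ⊕ A') (Buffers C n) where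
  step p x := {q | ∃ c, p.1.1 * β (projLeft A A' (.of x)) = c * q.1.1 ∧
    p.1.2 * γ (projRight A A' (.of x)) = c * q.1.2}
  start := {p | p.1 = (1, 1)}
  accept := {p | p.1 = (1, 1)}

/-- Reading a letter and cancelling both preserve, backwards along an accepting run, the equality of
the two sides: buffer times image of the remaining word. -/
theorem syncNFA_sound (n : ℕ) (w : List (A ⊕ A')) (S : Set (Buffers C n))
    (h : w ∈ (syncNFA β γ n).acceptsFrom S) :
    ∃ p ∈ S, p.1.1 * β (projLeft A A' (.ofList w)) = p.1.2 * γ (projRight A A' (.ofList w)) := by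
  induction w generalizing S with
  | nil =>
    obtain ⟨p, hp, hp'⟩ := (NFA.nil_mem_acceptsFrom _).1 h
    have hp1 : p.1 = (1, 1) := hp'
    exact ⟨p, hp, by simp [hp1]⟩
  | cons x w ih =>
    obtain ⟨q, hq, hqw⟩ := ih _ ((NFA.cons_mem_acceptsFrom _).1 h)
    obtain ⟨p, hp, c, h1, h2⟩ := NFA.mem_stepSet.1 hq
    refine ⟨p, hp, ?_⟩
    simp only [FreeMonoid.ofList_cons, map_mul, ← mul_assoc]
    rw [h1, h2, mul_assoc, mul_assoc, hqw]

/-- Reading always a letter for the side whose buffer is empty keeps the buffers bounded by the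
lengths of the images of single letters, and one of them empty. -/
theorem syncNFA_complete {n : ℕ} (hβ : ∀ a, (β (.of a)).length ≤ n)
    (hγ : ∀ a, (γ (.of a)).length ≤ n) (k : ℕ) (v : List A) (v' : List A')
    (hk : v.length + v'.length = k) (p : Buffers C n) (hp : p.1.1 = 1 ∨ p.1.2 = 1)
    (h : p.1.1 * β (.ofList v) = p.1.2 * γ (.ofList v')) :
    ∃ w ∈ (syncNFA β γ n).acceptsFrom {p},
      projLeft A A' (.ofList w) = .ofList v ∧ projRight A A' (.ofList w) = .ofList v' := by
  induction k generalizing v v' p with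
  | zero =>
    obtain ⟨rfl, rfl⟩ : v = [] ∧ v' = [] := by
      constructor <;> apply List.eq_nil_of_length_eq_zero <;> omega
    refine ⟨[], (NFA.nil_mem_acceptsFrom _).2 ⟨p, rfl, ?_⟩, by simp, by simp⟩
    simp only [FreeMonoid.ofList_nil, map_one, mul_one] at h
    exact Prod.ext (by grind) (by grind)
  | succ k ih =>
    -- `left` and `right` read one letter, after which the buffers are those of `q`
    let Lifts : Prop := ∃ w ∈ (syncNFA β γ n).acceptsFrom {p},
      projLeft A A' (.ofList w) = .ofList v ∧ projRight A A' (.ofList w) = .ofList v'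
    have left : ∀ a v₁ (q : Buffers C n) c, v = a :: v₁ → (q.1.1 = 1 ∨ q.1.2 = 1) →
        p.1.1 * β (.of a) = c * q.1.1 → p.1.2 = c * q.1.2 → Lifts := by
      rintro a v₁ q c rfl hq h1 h2
      obtain ⟨w, hw, hl, hr⟩ := ih v₁ v' (by simp at hk; omega) q hq (by
        apply mul_left_cancel (a := c)
        rw [← mul_assoc, ← mul_assoc, ← h1, ← h2, ← h, FreeMonoid.ofList_cons, map_mul, mul_assoc])
      refine ⟨.inl a :: w, ?_, ?_, ?_⟩
      · rw [NFA.cons_mem_acceptsFrom, NFA.stepSet_singleton]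
        obtain ⟨s, hs, hs'⟩ := hw
        exact ⟨s, hs, NFA.mem_evalFrom_iff_exists.2 ⟨q, ⟨c, h1, by
          rw [← h2]; exact (congrArg _ (map_one γ)).trans (mul_one _)⟩, hs'⟩⟩
      · rw [FreeMonoid.ofList_cons, map_mul, hl]; rfl
      · rw [FreeMonoid.ofList_cons, map_mul, hr]; exact one_mul _
    have right : ∀ a v₁ (q : Buffers C n) c, v' = a :: v₁ → (q.1.1 = 1 ∨ q.1.2 = 1) →
        p.1.1 = c * q.1.1 → p.1.2 * γ (.of a) = c * q.1.2 → Lifts := by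
      rintro a v₁ q c rfl hq h1 h2
      obtain ⟨w, hw, hl, hr⟩ := ih v v₁ (by simp at hk; omega) q hq (by
        apply mul_left_cancel (a := c)
        rw [← mul_assoc, ← mul_assoc, ← h1, ← h2, h, FreeMonoid.ofList_cons, map_mul, mul_assoc])
      refine ⟨.inr a :: w, ?_, ?_, ?_⟩
      · rw [NFA.cons_mem_acceptsFrom, NFA.stepSet_singleton]
        obtain ⟨s, hs, hs'⟩ := hw
        exact ⟨s, hs, NFA.mem_evalFrom_iff_exists.2 ⟨q, ⟨c, by
          rw [← h1]; exact (congrArg _ (map_one β)).trans (mul_one _), h2⟩, hs'⟩⟩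
      · rw [FreeMonoid.ofList_cons, map_mul, hl]; exact one_mul _
      · rw [FreeMonoid.ofList_cons, map_mul, hr]; rfl
    obtain ⟨⟨x, y⟩, hx, hy⟩ := p
    change x = 1 ∨ y = 1 at hp
    change x * _ = y * _ at h
    dsimp only at left right hx hy
    have advanceLeft : ∀ a v₁, v = a :: v₁ → x = 1 → Lifts := fun a v₁ hv hx1 => by
      subst hx1
      rw [hv, FreeMonoid.ofList_cons, map_mul, one_mul] at h
      rcases FreeMonoid.mul_eq_mul_cases h with ⟨t, ht, -⟩ | ⟨t, ht, -⟩
      · have hlen := congrArg FreeMonoid.length ht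
        rw [FreeMonoid.length_mul] at hlen
        exact left a v₁ ⟨(1, t), by simp, by simp only; omega⟩ _ hv (.inl rfl) (by simp) ht
      · have hlen := congrArg FreeMonoid.length ht
        have ha := hβ a
        rw [FreeMonoid.length_mul] at hlen
        exact left a v₁ ⟨(t, 1), by simp only; omega, by simp⟩ y hv (.inr rfl) (by simpa using ht)
          (by simp)
    have advanceRight : ∀ a v₁, v' = a :: v₁ → y = 1 → Lifts := fun a v₁ hv hy1 => by
      subst hy1
      rw [hv, FreeMonoid.ofList_cons, map_mul, one_mul] at h
      rcases FreeMonoid.mul_eq_mul_cases h with ⟨t, ht, -⟩ | ⟨t, ht, -⟩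
      · have hlen := congrArg FreeMonoid.length ht
        have ha := hγ a
        rw [FreeMonoid.length_mul] at hlen
        exact right a v₁ ⟨(1, t), by simp, by simp only; omega⟩ x hv (.inl rfl) (by simp)
          (by simpa using ht)
      · have hlen := congrArg FreeMonoid.length ht
        rw [FreeMonoid.length_mul] at hlen
        exact right a v₁ ⟨(t, 1), by simp only; omega, by simp⟩ _ hv (.inr rfl) ht (by simp)
    -- if the side with an empty buffer has no letters left, then the other buffer is empty too
    rcases v with _ | ⟨a, v₁⟩
    · rcases v' with _ | ⟨a', v₁'⟩
      · simp at hk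
      · refine advanceRight a' v₁' rfl ?_
        rcases hp with hx1 | hy1
        · subst hx1
          simp only [FreeMonoid.ofList_nil, map_one, mul_one] at h
          have := congrArg FreeMonoid.length h
          rw [FreeMonoid.length_mul, FreeMonoid.length_one] at this
          exact FreeMonoid.length_eq_zero.1 (by omega)
        · exact hy1
    · rcases hp with hx1 | hy1
      · exact advanceLeft a v₁ rfl hx1
      · rcases v' with _ | ⟨a', v₁'⟩
        · refine advanceLeft a v₁ rfl ?_
          subst hy1
          simp only [FreeMonoid.ofList_nil, map_one, mul_one] at h
          have := congrArg FreeMonoid.length h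
          rw [FreeMonoid.length_mul, FreeMonoid.length_one] at this
          exact FreeMonoid.length_eq_zero.1 (by omega)
        · exact advanceRight a' v₁' rfl hy1

/-- The words over `A ⊕ A'` on which `β ∘ π` and `γ ∘ π'` agree need not form a regular language,
but they contain a regular language with the same pairs of projections. -/
theorem exists_regular_synchronization [Finite A] [Finite A'] [Finite C] :
    ∃ K : Language (A ⊕ A'), K.IsRegular ∧
      (∀ w ∈ K, β (projLeft A A' (.ofList w)) = γ (projRight A A' (.ofList w))) ∧
      ∀ v v', β v = γ v' → ∃ w ∈ K,
        projLeft A A' (.ofList w) = v ∧ projRight A A' (.ofList w) = v' := by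
  obtain ⟨m, hm⟩ := (Set.finite_range fun a => (β (.of a)).length).bddAbove
  obtain ⟨m', hm'⟩ := (Set.finite_range fun a => (γ (.of a)).length).bddAbove
  set n := max m m'
  have hβ : ∀ a, (β (.of a)).length ≤ n := fun a => (hm ⟨a, rfl⟩).trans (le_max_left _ _)
  have hγ : ∀ a, (γ (.of a)).length ≤ n := fun a => (hm' ⟨a, rfl⟩).trans (le_max_right _ _)
  have hfin : Finite (Buffers C n) :=
    ((List.finite_length_le C n).prod (List.finite_length_le C n)).to_subtype
  have := Fintype.ofFinite (Buffers C n)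
  have hstart : (syncNFA β γ n).start = {⟨(1, 1), by simp, by simp⟩} := by
    ext p
    exact Iff.symm (Subtype.ext_iff (a2 := ⟨(1, 1), by simp, by simp⟩))
  refine ⟨(syncNFA β γ n).accepts,
    ⟨Set (Buffers C n), Fintype.ofFinite _, _, NFA.toDFA_correct⟩, ?_, ?_⟩
  · intro w hw
    rw [NFA.accepts_eq_acceptsFrom_start, hstart] at hw
    obtain ⟨p, rfl, hpw⟩ := syncNFA_sound β γ n w _ hw
    simpa using hpw
  · intro v v' h
    rw [NFA.accepts_eq_acceptsFrom_start, hstart]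
    exact syncNFA_complete β γ hβ hγ _ v.toList v'.toList rfl _ (.inl rfl) (by simpa using h)

end Synchronization

/-! ### Adjoining identities -/

/-- An associative composition of nontrivial morphisms extends to a category in which identities
are adjoined freely. -/
def WithIdentities.categoryOn {Ob : Type 1} (M : Ob → Ob → Type 1)
    (comp : ∀ {X Y Z}, M X Y → M Y Z → M X Z)
    (assoc : ∀ {W X Y Z} (f : M W X) (g : M X Y) (h : M Y Z),
      comp (comp f g) h = comp f (comp g h)) : CategoryOn Ob (WithIdentities M) where
  id := .ident
  comp
    | .ident _, g => g
    | .of f, .ident _ => .of f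
    | .of f, .of g => .of (comp f g)
  id_comp _ := rfl
  comp_id f := by cases f <;> rfl
  assoc f g h := by
    cases f <;> cases g <;> cases h <;> first | rfl | exact congrArg _ (assoc _ _ _)

/-! ### Words and couplings on a disjoint union of alphabets -/

theorem exists_projections_eq {A A' : Type} (v : FreeMonoid A) (v' : FreeMonoid A') :
    ∃ w, projLeft A A' w = v ∧ projRight A A' w = v' := by
  have h1 : (projLeft A A').comp (FreeMonoid.map Sum.inr) = 1 := FreeMonoid.hom_eq fun _ => rfl
  have h2 : (projRight A A').comp (FreeMonoid.map Sum.inl) = 1 := FreeMonoid.hom_eq fun _ => rfl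
  refine ⟨FreeMonoid.map Sum.inl v * FreeMonoid.map Sum.inr v', ?_, ?_⟩
  · rw [map_mul, projLeft_map_inl, show projLeft A A' (FreeMonoid.map Sum.inr v') = 1 from
      DFunLike.congr_fun h1 v', mul_one]
  · rw [map_mul, projRight_map_inr, show projRight A A' (FreeMonoid.map Sum.inl v) = 1 from
      DFunLike.congr_fun h2 v, one_mul]

theorem compJ_congr {A A' A₁ A₁' B D : Type} {α : FreeMonoid A →* FreeMonoid B}
    {β' : FreeMonoid A' →* FreeMonoid D} {α₁ : FreeMonoid A₁ →* FreeMonoid B}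
    {β₁' : FreeMonoid A₁' →* FreeMonoid D} {J : A → ℝ≥0} {J' : A' → ℝ≥0} {J₁ : A₁ → ℝ≥0}
    {J₁' : A₁' → ℝ≥0} (e : A ≃ A₁) (e' : A' ≃ A₁') (hα : ∀ a, α₁ (.of (e a)) = α (.of a))
    (hβ : ∀ a, β₁' (.of (e' a)) = β' (.of a)) (hJ : ∀ a, J₁ (e a) = J a)
    (hJ' : ∀ a, J₁' (e' a) = J' a) (x : A ⊕ A') :
    compJ α₁ β₁' J₁ J₁' (e.sumCongr e' x) = compJ α β' J J' x := by
  rcases x with a | a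
  · by_cases h : α (.of a) = 1
    · simp [compJ, h, (hα a).trans h]
    · simp [compJ, h, hα a, hJ]
  · by_cases h : β' (.of a) = 1
    · simp [compJ, h, (hβ a).trans h]
    · simp [compJ, h, hβ a, hJ']

/-- A letter of the middle alphabet is killed by both homomorphisms of the triple composite, and gets
the coupling `0` under either bracketing. -/
theorem compJ_assoc {A₁ A₂ A₃ B C D E : Type} (α₁ : FreeMonoid A₁ →* FreeMonoid B)
    (α₂ : FreeMonoid A₂ →* FreeMonoid C) (β₂ : FreeMonoid A₂ →* FreeMonoid D)
    (β₃ : FreeMonoid A₃ →* FreeMonoid E) (J₁ : A₁ → ℝ≥0) (J₂ : A₂ → ℝ≥0) (J₃ : A₃ → ℝ≥0)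
    (x : (A₁ ⊕ A₂) ⊕ A₃) :
    compJ α₁ (β₃.comp (projRight A₂ A₃)) J₁ (compJ α₂ β₃ J₂ J₃) (Equiv.sumAssoc _ _ _ x) =
      compJ (α₁.comp (projLeft A₁ A₂)) β₃ (compJ α₁ β₂ J₁ J₂) J₃ x := by
  have hl : ∀ a, projLeft A₁ A₂ (.of (.inl a)) = .of a := fun _ => rfl
  have hl' : ∀ a, projLeft A₁ A₂ (.of (.inr a)) = 1 := fun _ => rfl
  have hr : ∀ a, projRight A₂ A₃ (.of (.inl a)) = 1 := fun _ => rfl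
  have hr' : ∀ a, projRight A₂ A₃ (.of (.inr a)) = .of a := fun _ => rfl
  rcases x with (a | a) | a <;> simp +contextual [compJ, hl, hl', hr, hr']

/-! ### Composition of common decimations -/

namespace CommonDecimation

variable {b : ℝ} {S T U V : SpinChainSet}

/-- The words of a common decimation are disconnections, so its graph can be read off without the
letter `o`. -/
theorem mem_graph_iff (P : CommonDecimation b S T) (x : FreeMonoid S.alphabet)
    (y : FreeMonoid T.alphabet) : (x, y) ∈ P.graph ↔
      ∃ v, disconnectWord (samePiece P.α P.β) v ∈ P.words ∧ P.α v = x ∧ P.β v = y := by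
  constructor
  · rintro ⟨u, hu, h⟩
    obtain ⟨v, -, rfl⟩ := P.words_subset hu
    simp only [extendO_disconnectWord, Prod.mk.injEq] at h
    exact ⟨v, hu, h⟩
  · rintro ⟨v, hv, rfl, rfl⟩
    exact ⟨_, hv, by simp only [extendO_disconnectWord]⟩

theorem graph_comp (P : CommonDecimation b S T) (Q : CommonDecimation b T U) :
    (P.comp Q).graph = SetRel.comp P.graph Q.graph := by
  ext ⟨x, z⟩
  rw [SetRel.mem_comp]
  simp only [mem_graph_iff]
  constructor
  · rintro ⟨w, ⟨w', ⟨h1, h2, h3⟩, hw⟩, hx, hz⟩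
    have hα := (extendO_disconnectWord (P.comp Q).α _ w').symm.trans
      ((congrArg (extendO (P.comp Q).α) hw).trans (extendO_disconnectWord _ _ w))
    have hβ := (extendO_disconnectWord (P.comp Q).β _ w').symm.trans
      ((congrArg (extendO (P.comp Q).β) hw).trans (extendO_disconnectWord _ _ w))
    exact ⟨_, ⟨_, h1, hα.trans hx, rfl⟩, _, h2, h3.symm, hβ.trans hz⟩
  · rintro ⟨y, ⟨v, hv, hx, hy⟩, v', hv', hy', hz⟩
    obtain ⟨w, rfl, rfl⟩ := exists_projections_eq v v'
    exact ⟨w, ⟨w, ⟨hv, hv', hy.trans hy'.symm⟩, rfl⟩, hx, hz⟩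

theorem comp_equivalent {P P' : CommonDecimation b S T} {Q Q' : CommonDecimation b T U}
    (h : P.Equivalent P') (h' : Q.Equivalent Q') : (P.comp Q).Equivalent (P'.comp Q') := by
  obtain ⟨⟨e, he⟩, hg⟩ := h
  obtain ⟨⟨e', he'⟩, hg'⟩ := h'
  refine ⟨⟨e.sumCongr e', ?_⟩, by rw [graph_comp, graph_comp, hg, hg']⟩
  have hJ := compJ_congr (J := fun a => P.J (some a)) (J' := fun a => Q.J (some a))
    (J₁ := fun a => P'.J (some a)) (J₁' := fun a => Q'.J (some a)) e e' (fun a => (he a).1)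
    (fun a => (he' a).2.1) (fun a => (he a).2.2) fun a => (he' a).2.2
  rintro (a | a)
  · exact ⟨(he a).1, (map_one Q'.β).trans (map_one Q.β).symm, hJ (.inl a)⟩
  · exact ⟨(map_one P'.α).trans (map_one P.α).symm, (he' a).2.1, hJ (.inr a)⟩

theorem comp_assoc_equivalent (P : CommonDecimation b S T) (Q : CommonDecimation b T U)
    (R : CommonDecimation b U V) : ((P.comp Q).comp R).Equivalent (P.comp (Q.comp R)) := by
  refine ⟨⟨Equiv.sumAssoc _ _ _, ?_⟩, by simp only [graph_comp, SetRel.comp_assoc]⟩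
  have hJ := compJ_assoc P.α Q.α Q.β R.β
    (fun a => P.J (some a)) (fun a => Q.J (some a)) (fun a => R.J (some a))
  rintro ((a | a) | a)
  · exact ⟨rfl, rfl, hJ (.inl (.inl a))⟩
  · exact ⟨rfl, rfl, hJ (.inl (.inr a))⟩
  · exact ⟨rfl, rfl, hJ (.inr a)⟩

/-- Composition of classes of common decimations. -/
noncomputable def compQuotient (p : Quotient (setoid b S T)) (q : Quotient (setoid b T U)) :
    Quotient (setoid b S U) :=
  Quotient.map₂ comp (fun _ _ h _ _ h' => comp_equivalent h h') p q

theorem compQuotient_assoc (p : Quotient (setoid b S T)) (q : Quotient (setoid b T U))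
    (r : Quotient (setoid b U V)) :
    compQuotient (compQuotient p q) r = compQuotient p (compQuotient q r) := by
  induction p using Quotient.inductionOn
  induction q using Quotient.inductionOn
  induction r using Quotient.inductionOn
  exact Quotient.sound (comp_assoc_equivalent _ _ _)

end CommonDecimation

/-! ### Composition of coupled transductions -/

namespace CoupledTransduction

variable {b : ℝ} {W X Y Z : CFLJ}

theorem mem_words_of_mem_graph (P : CoupledTransduction b X Y) {x : FreeMonoid X.alphabet}
    {y : FreeMonoid Y.alphabet} (h : (x, y) ∈ P.graph) (hx : x ∈ X.words) : y ∈ Y.words := by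
  obtain ⟨v, hv, hvxy⟩ := h
  obtain ⟨rfl, rfl⟩ := Prod.mk.inj hvxy
  exact P.image_subset ⟨v, ⟨hx, hv⟩, rfl⟩

theorem image_compLang (P : CoupledTransduction b X Y) (Q : CoupledTransduction b Y Z) :
    (fun w => (P.α (projLeft _ _ w), Q.β (projRight _ _ w))) '' compLang P Q =
      SetRel.comp P.graph Q.graph := by
  ext ⟨x, z⟩
  rw [SetRel.mem_comp]
  constructor
  · rintro ⟨w, ⟨h1, h2, h3⟩, h⟩
    obtain ⟨rfl, rfl⟩ := Prod.mk.inj h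
    exact ⟨_, ⟨_, h1, rfl⟩, _, h2, Prod.ext h3.symm rfl⟩
  · rintro ⟨y, ⟨v, hv, h⟩, v', hv', h'⟩
    obtain ⟨rfl, rfl⟩ := Prod.mk.inj h
    obtain ⟨hy, rfl⟩ := Prod.mk.inj h'
    obtain ⟨w, rfl, rfl⟩ := exists_projections_eq v v'
    exact ⟨w, ⟨hv, hv', hy.symm⟩, rfl⟩

/-- The relation identified with the composite is presented by a regular language over the
disjoint union of the alphabets. -/
theorem exists_regular_composite (P : CoupledTransduction b X Y) (Q : CoupledTransduction b Y Z) :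
    ∃ K : Language (P.alphabet ⊕ Q.alphabet), K.IsRegular ∧
      (fun w => (P.α (projLeft _ _ w), Q.β (projRight _ _ w))) '' {w | w.toList ∈ K} =
        SetRel.comp P.graph Q.graph := by
  have := P.finite
  have := Q.finite
  have := Y.finite
  obtain ⟨K, hK, hsound, hcomplete⟩ := exists_regular_synchronization P.β Q.α
  refine ⟨K ⊓ (_ ⊓ _), hK.inf ((P.isRegular.preimage_hom (projLeft _ Q.alphabet)).inf
    (Q.isRegular.preimage_hom (projRight P.alphabet _))), ?_⟩
  rw [← image_compLang]
  apply Set.Subset.antisymm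
  · rintro _ ⟨w, ⟨h1, h2, h3⟩, rfl⟩
    exact ⟨w, ⟨h2, h3, hsound _ h1⟩, rfl⟩
  · rintro _ ⟨w, ⟨h1, h2, h3⟩, rfl⟩
    obtain ⟨u, hu, hl, hr⟩ := hcomplete _ _ h3
    refine ⟨.ofList u, ⟨hu, ?_, ?_⟩, Prod.ext (congrArg P.α hl) (congrArg Q.β hr)⟩
    · exact (congrArg (fun v => FreeMonoid.toList v ∈ P.reg) hl).mpr h1
    · exact (congrArg (fun v => FreeMonoid.toList v ∈ Q.reg) hr).mpr h2

/-- A composite of two coupled transductions. The regular language is any one that presents the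
composite relation; its choice does not affect the class of the composite. -/
noncomputable def comp (P : CoupledTransduction b X Y) (Q : CoupledTransduction b Y Z) :
    CoupledTransduction b X Z where
  alphabet := P.alphabet ⊕ Q.alphabet
  finite := haveI := P.finite; haveI := Q.finite; inferInstance
  α := P.α.comp (projLeft _ _)
  β := Q.β.comp (projRight _ _)
  reg := (exists_regular_composite P Q).choose
  isRegular := (exists_regular_composite P Q).choose_spec.1
  cover_left := fun u hu => by
    obtain ⟨w, rfl⟩ := P.cover_left hu
    exact ⟨FreeMonoid.map Sum.inl w, by simp [projLeft_map_inl]⟩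
  cover_right := fun u hu => by
    obtain ⟨w, rfl⟩ := Q.cover_right hu
    exact ⟨FreeMonoid.map Sum.inr w, by simp [projRight_map_inr]⟩
  image_subset := by
    rintro _ ⟨w, ⟨hx, hw⟩, rfl⟩
    obtain ⟨y, h, h'⟩ := (exists_regular_composite P Q).choose_spec.2.subset ⟨w, hw, rfl⟩
    exact Q.mem_words_of_mem_graph h' (P.mem_words_of_mem_graph h hx)
  J := compJ P.α Q.β P.J Q.J
  isHatJ := isHatJ_compJ P.isHatJ Q.isHatJ

theorem graph_comp (P : CoupledTransduction b X Y) (Q : CoupledTransduction b Y Z) :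
    (P.comp Q).graph = SetRel.comp P.graph Q.graph :=
  (exists_regular_composite P Q).choose_spec.2

theorem isComposite_comp (P : CoupledTransduction b X Y) (Q : CoupledTransduction b Y Z) :
    P.IsComposite Q (P.comp Q) :=
  ⟨⟨Equiv.refl _, fun _ => ⟨rfl, rfl, rfl⟩⟩, by rw [graph_comp, image_compLang]⟩

theorem comp_equivalent {P P' : CoupledTransduction b X Y} {Q Q' : CoupledTransduction b Y Z}
    (h : P.Equivalent P') (h' : Q.Equivalent Q') : (P.comp Q).Equivalent (P'.comp Q') := by
  obtain ⟨⟨e, he⟩, hg⟩ := h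
  obtain ⟨⟨e', he'⟩, hg'⟩ := h'
  refine ⟨⟨e.sumCongr e', ?_⟩, by rw [graph_comp, graph_comp, hg, hg']⟩
  have hJ := compJ_congr e e' (fun a => (he a).1) (fun a => (he' a).2.1) (fun a => (he a).2.2)
    fun a => (he' a).2.2
  rintro (a | a)
  · exact ⟨(he a).1, (map_one Q'.β).trans (map_one Q.β).symm, hJ (.inl a)⟩
  · exact ⟨(map_one P'.α).trans (map_one P.α).symm, (he' a).2.1, hJ (.inr a)⟩

theorem comp_assoc_equivalent (P : CoupledTransduction b W X) (Q : CoupledTransduction b X Y)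
    (R : CoupledTransduction b Y Z) : ((P.comp Q).comp R).Equivalent (P.comp (Q.comp R)) := by
  refine ⟨⟨Equiv.sumAssoc _ _ _, ?_⟩, by simp only [graph_comp, SetRel.comp_assoc]⟩
  have hJ := compJ_assoc P.α Q.α Q.β R.β P.J Q.J R.J
  rintro ((a | a) | a)
  · exact ⟨rfl, rfl, hJ (.inl (.inl a))⟩
  · exact ⟨rfl, rfl, hJ (.inl (.inr a))⟩
  · exact ⟨rfl, rfl, hJ (.inr a)⟩

/-- Composition of classes of coupled transductions. -/
noncomputable def compQuotient (p : Quotient (setoid b X Y)) (q : Quotient (setoid b Y Z)) :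
    Quotient (setoid b X Z) :=
  Quotient.map₂ comp (fun _ _ h _ _ h' => comp_equivalent h h') p q

theorem compQuotient_assoc (p : Quotient (setoid b W X)) (q : Quotient (setoid b X Y))
    (r : Quotient (setoid b Y Z)) :
    compQuotient (compQuotient p q) r = compQuotient p (compQuotient q r) := by
  induction p using Quotient.inductionOn
  induction q using Quotient.inductionOn
  induction r using Quotient.inductionOn
  exact Quotient.sound (comp_assoc_equivalent _ _ _)

/-- Intersecting with the languages commutes with composition of the relations, since the
intermediate word lies in the middle language as soon as the first word lies in the first one. -/
theorem toDecimation_comp_equivalent (P : CoupledTransduction b X Y)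
    (Q : CoupledTransduction b Y Z) :
    (toDecimation (P.comp Q)).Equivalent ((toDecimation P).comp (toDecimation Q)) := by
  refine ⟨⟨Equiv.refl _, fun _ => ⟨rfl, rfl, rfl⟩⟩, ?_⟩
  rw [CommonDecimation.graph_comp, toDecimation_graph, toDecimation_graph, toDecimation_graph,
    graph_comp]
  ext ⟨x, z⟩
  constructor
  · rintro ⟨⟨y, h, h'⟩, hx, hz⟩
    have hy := P.mem_words_of_mem_graph h hx
    exact ⟨y, ⟨h, hx, hy⟩, h', hy, hz⟩
  · rintro ⟨y, ⟨h, hx, -⟩, h', -, hz⟩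
    exact ⟨⟨y, h, h'⟩, hx, hz⟩

end CoupledTransduction

/-! ### The categories and the functor -/

/-- The category of context-free languages with couplings. -/
noncomputable def cfljCategoryOn (b : ℝ) : CategoryOn CFLJ (CFLJHom b) :=
  WithIdentities.categoryOn _ CoupledTransduction.compQuotient
    CoupledTransduction.compQuotient_assoc

/-- The category of spin chain sets. -/
noncomputable def spinCategoryOn (b : ℝ) : CategoryOn SpinChainSet (SpinHom b) :=
  WithIdentities.categoryOn _ CommonDecimation.compQuotient CommonDecimation.compQuotient_assoc

theorem spinMap_comp (b : ℝ) {X Y Z : CFLJ} (f : CFLJHom b X Y) (g : CFLJHom b Y Z) :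
    spinMap b ((cfljCategoryOn b).comp f g) =
      (spinCategoryOn b).comp (spinMap b f) (spinMap b g) := by
  cases f with
  | ident => rfl
  | of p =>
    cases g with
    | ident => rfl
    | of q =>
      induction p using Quotient.inductionOn
      induction q using Quotient.inductionOn
      exact congrArg WithIdentities.of
        (Quotient.sound (CoupledTransduction.toDecimation_comp_equivalent _ _))

theorem theorem3p7 (b : ℝ) (hb : 0 < b) :
    (∀ (X Y : CFLJ) (T : Transduction X Y),
      (∃! Jhat : T.alphabet → ℝ≥0, IsHatJ b T.α T.β X.J Y.J Jhat) ↔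
        DecimationCompatible b T.α T.β X.J Y.J) ∧
    ∃ (C : CategoryOn CFLJ (CFLJHom b)) (D : CategoryOn SpinChainSet (SpinHom b)),
      (∀ X, C.id X = .ident X) ∧
      (∀ {X Y Z : CFLJ} (P : CoupledTransduction b X Y) (Q : CoupledTransduction b Y Z),
        ∃ R : CoupledTransduction b X Z, P.IsComposite Q R ∧
          C.comp (.of ⟦P⟧) (.of ⟦Q⟧) = .of ⟦R⟧) ∧
      (∀ S, D.id S = .ident S) ∧
      (∀ {S T U : SpinChainSet} (P : CommonDecimation b S T) (Q : CommonDecimation b T U),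
        D.comp (.of ⟦P⟧) (.of ⟦Q⟧) = .of ⟦P.comp Q⟧) ∧
      letI := C.toCategory
      letI := D.toCategory
      ∃ F : CategoryTheory.Functor CFLJ SpinChainSet,
        F.toPrefunctor = ⟨spinObj, spinMap b⟩ ∧
        (∀ X : CFLJ, (F.obj X).system = ⟨X.words, fun w => wordChain X.J w.1⟩) ∧
        (∀ {X Y : CFLJ} (P : CoupledTransduction b X Y),
          (toDecimation P).graph = P.graph ∩ X.words ×ˢ Y.words) := by
  refine ⟨fun X Y T => existsUnique_isHatJ_iff hb _ _ _ _, cfljCategoryOn b, spinCategoryOn b,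
    fun _ => rfl, fun P Q => ⟨P.comp Q, P.isComposite_comp Q, rfl⟩, fun _ => rfl,
    fun _ _ => rfl, ?_⟩
  let _ := (cfljCategoryOn b).toCategory
  let _ := (spinCategoryOn b).toCategory
  exact ⟨{ obj := spinObj, map := fun f => spinMap b f, map_id := fun _ => rfl,
           map_comp := fun f g => spinMap_comp b f g }, rfl, fun _ => rfl, toDecimation_graph⟩
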